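/- Let $K$ be a field, let $\mathcal G$ be an ample Hausdorff groupoid (a Hausdorff topological groupoid whose unit space $\mathcal G^{(0)}$ is locally compact and zero-dimensional and whose range map $r:\mathcal G\to\mathcal G^{(0)}$ is a local homeomorphism), let $\Gamma$ be a discrete group with identity $e$, and let $c:\mathcal G\to\Gamma$ be a locally constant cocycle, i.e. a locally constant map with $c(\gamma_1\gamma_2)=c(\gamma_1)c(\gamma_2)$ for all composable $\gamma_1,\gamma_2$. The Steinberg algebra $A_K(\mathcal G)$ is the $K$-algebra of locally constant, compactly supported functions $\mathcal G\to K$ with the convolution product $(fg)(\gamma)=\sum_{\gamma_1\gamma_2=\gamma}f(\gamma_1)g(\gamma_2)$. It is $\Gamma$-graded by the subspaces $A_g$, $g\in\Gamma$, of functions vanishing outside $c^{-1}(g)$, and a two-sided ideal $J$ of $A_K(\mathcal G)$ is graded if $J=\bigoplus_{g\in\Gamma}(J\cap A_g)$. A set $U\subseteq\mathcal G^{(0)}$ is invariant if, for every $\gamma\in\mathcal G$, $r(\gamma)\in U$ if and only if $s(\gamma)\in U$, where $s$ is the source map; in that case $\mathcal G|_U=\{\gamma\in\mathcal G:r(\gamma)\in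 U\}$, a subgroupoid of $\mathcal G$. If $U$ is also open, $A_K(\mathcal G|_U)$ is regarded as a subset of $A_K(\mathcal G)$ through extension of functions by zero. A topological groupoid $\mathcal H$ is effective if the interior of $\{\gamma\in\mathcal H:r(\gamma)=s(\gamma)\}$ in $\mathcal H$ equals $\mathcal H^{(0)}$, and strongly effective if $\mathcal H|_C$ is effective for every closed invariant set $C\subseteq\mathcal H^{(0)}$. Suppose that the groupoid $c^{-1}(e)$ is strongly effective. Then $$U\mapsto A_K(\mathcal G|_U)$$ is an isomorphism from the lattice of open invariant subsets of $\mathcal G^{(0)}$ (with union and intersection) onto the lattice of graded ideals of $A_K(\mathcal G)$ (with sum and intersection). -/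

import Mathlib

/-! ### Groupoids -/

/-- A groupoid presented by its set of arrows `G`.  Units are identified with identity arrows, so
source and range take values in `G`; the product of `a` and `b` exists exactly when
`src a = rng b`. -/
class ArrowGroupoid (G : Type*) where
  src : G → G
  rng : G → G
  mul : (a b : G) → src a = rng b → G
  inv : G → G
  src_src : ∀ a, src (src a) = src a
  rng_src : ∀ a, rng (src a) = src a
  src_rng : ∀ a, src (rng a) = rng a
  rng_rng : ∀ a, rng (rng a) = rng a
  src_mul : ∀ a b h, src (mul a b h) = src b
  rng_mul : ∀ a b h, rng (mul a b h) = rng a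
  mul_assoc : ∀ a b c (hab : src a = rng b) (hbc : src b = rng c),
    mul (mul a b hab) c ((src_mul a b hab).trans hbc) =
      mul a (mul b c hbc) (hab.trans (rng_mul b c hbc).symm)
  mul_src : ∀ a, mul a (src a) (rng_src a).symm = a
  rng_mul_self : ∀ a, mul (rng a) a (src_rng a) = a
  src_inv : ∀ a, src (inv a) = rng a
  rng_inv : ∀ a, rng (inv a) = src a
  inv_mul : ∀ a, mul (inv a) a (src_inv a) = src a
  mul_inv : ∀ a, mul a (inv a) (rng_inv a).symm = rng a

namespace ArrowGroupoid

/-- The unit space of `G`; it carries the relative topology when `G` is a space. -/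
abbrev UnitSpace (G : Type*) [ArrowGroupoid G] : Type _ := {x : G // src x = x}

section Algebraic

variable {G : Type*} [ArrowGroupoid G]

/-- The source map, as a map to the unit space. -/
def s (a : G) : UnitSpace G := ⟨src a, src_src a⟩

/-- The range map, as a map to the unit space. -/
def r (a : G) : UnitSpace G := ⟨rng a, src_rng a⟩

/-- A set of units is invariant if it contains the range of an arrow exactly when it contains
the source of that arrow. -/
def Invariant (U : Set (UnitSpace G)) : Prop := ∀ a : G, r a ∈ U ↔ s a ∈ U

variable (G) in
/-- The isotropy bundle of `G`. -/
def Iso : Set G := {a | rng a = src a}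

/-- A map to a group that is multiplicative on composable pairs. -/
def IsCocycle {Γ : Type*} [Group Γ] (c : G → Γ) : Prop :=
  ∀ (a b : G) (h : src a = rng b), c (mul a b h) = c a * c b

lemma mul_congr {a a' b b' : G} (ha : a = a') (hb : b = b') (h : src a = rng b)
    (h' : src a' = rng b') : mul a b h = mul a' b' h' := by
  subst ha; subst hb; rfl

lemma inv_mul_cancel_left (a b : G) (h : src a = rng b) (h' : src (inv a) = rng (mul a b h)) :
    mul (inv a) (mul a b h) h' = b := by
  rw [← mul_assoc (inv a) a b (src_inv a) h]
  rw [mul_congr ((inv_mul a).trans h) rfl _ (src_rng b), rng_mul_self]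

lemma inv_inv (a : G) : inv (inv a) = a := by
  have h : mul (inv (inv a)) (mul (inv a) a (src_inv a))
      ((src_inv _).trans (rng_mul _ _ _).symm) = a := inv_mul_cancel_left _ _ _ _
  rw [mul_congr rfl (inv_mul a) _ (by rw [src_inv, rng_inv, rng_src])] at h
  rw [mul_congr rfl (show src a = src (inv (inv a)) by rw [src_inv, rng_inv]) _
    (rng_src _).symm, mul_src] at h
  exact h

lemma mul_inv_cancel_left (a b : G) (h : rng a = rng b)
    (h' : src a = rng (mul (inv a) b ((src_inv a).trans h))) :
    mul a (mul (inv a) b ((src_inv a).trans h)) h' = b := by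
  rw [mul_congr (inv_inv a).symm rfl h' ((src_inv _).trans (rng_mul _ _ _).symm)]
  exact inv_mul_cancel_left _ _ _ _

end Algebraic

/-! ### Subgroupoids -/

/-- A subset of `G` closed under products and inverses. -/
structure Sub (G : Type*) [ArrowGroupoid G] where
  carrier : Set G
  mul_mem : ∀ (a b : G) (h : src a = rng b), a ∈ carrier → b ∈ carrier → mul a b h ∈ carrier
  inv_mem : ∀ a ∈ carrier, inv a ∈ carrier

section Subgroupoids

variable {G : Type*} [ArrowGroupoid G]

lemma Sub.src_mem (S : Sub G) (a : G) (ha : a ∈ S.carrier) : src a ∈ S.carrier := by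
  rw [← inv_mul a]; exact S.mul_mem _ _ _ (S.inv_mem a ha) ha

lemma Sub.rng_mem (S : Sub G) (a : G) (ha : a ∈ S.carrier) : rng a ∈ S.carrier := by
  rw [← mul_inv a]; exact S.mul_mem _ _ _ ha (S.inv_mem a ha)

/-- A subgroupoid is a groupoid in its own right. -/
instance (S : Sub G) : ArrowGroupoid S.carrier where
  src a := ⟨src a.1, S.src_mem a.1 a.2⟩
  rng a := ⟨rng a.1, S.rng_mem a.1 a.2⟩
  mul a b h := ⟨mul a.1 b.1 (congrArg Subtype.val h),
    S.mul_mem a.1 b.1 (congrArg Subtype.val h) a.2 b.2⟩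
  inv a := ⟨inv a.1, S.inv_mem a.1 a.2⟩
  src_src a := Subtype.ext (src_src a.1)
  rng_src a := Subtype.ext (rng_src a.1)
  src_rng a := Subtype.ext (src_rng a.1)
  rng_rng a := Subtype.ext (rng_rng a.1)
  src_mul a b _ := Subtype.ext (src_mul a.1 b.1 _)
  rng_mul a b _ := Subtype.ext (rng_mul a.1 b.1 _)
  mul_assoc a b c _ _ := Subtype.ext (mul_assoc a.1 b.1 c.1 _ _)
  mul_src a := Subtype.ext (mul_src a.1)
  rng_mul_self a := Subtype.ext (rng_mul_self a.1)
  src_inv a := Subtype.ext (src_inv a.1)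
  rng_inv a := Subtype.ext (rng_inv a.1)
  inv_mul a := Subtype.ext (inv_mul a.1)
  mul_inv a := Subtype.ext (mul_inv a.1)

/-- The restriction `G|_U` of `G` to an invariant set of units. -/
def restrict (U : Set (UnitSpace G)) (hU : Invariant U) : Sub G where
  carrier := {a | r a ∈ U}
  mul_mem a b h ha _ := by
    have : r (mul a b h) = r a := Subtype.ext (rng_mul a b h)
    simpa [this] using ha
  inv_mem a ha := by
    have : r (inv a) = s a := Subtype.ext (rng_inv a)
    simpa [this] using (hU a).1 ha

lemma IsCocycle.map_rng {Γ : Type*} [Group Γ] {c : G → Γ} (hc : IsCocycle c) (a : G) :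
    c (rng a) = 1 := by
  have h := hc (rng a) a (src_rng a)
  rw [rng_mul_self] at h
  simpa using h.symm

/-- The subgroupoid of arrows on which a cocycle takes the value `1`. -/
def kernel {Γ : Type*} [Group Γ] (c : G → Γ) (hc : IsCocycle c) : Sub G where
  carrier := {a | c a = 1}
  mul_mem a b h ha hb := by
    simp only [Set.mem_ofPred_eq] at *
    rw [hc, ha, hb, one_mul]
  inv_mem a ha := by
    simp only [Set.mem_ofPred_eq] at *
    have h := hc a (inv a) (rng_inv a).symm
    rw [mul_inv, hc.map_rng, ha, one_mul] at h
    exact h.symm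

end Subgroupoids

/-! ### Topological conditions -/

/-- Étale topological groupoids: product and inverse are continuous, the unit space is locally
compact, and the range map is a local homeomorphism onto the unit space.  (The Hausdorff property
is assumed separately.) -/
class IsEtale (G : Type*) [TopologicalSpace G] [ArrowGroupoid G] : Prop where
  continuous_mul : Continuous fun p : {p : G × G // src p.1 = rng p.2} => mul p.1.1 p.1.2 p.2
  continuous_inv : Continuous (inv : G → G)
  locallyCompact_units : LocallyCompactSpace (UnitSpace G)
  isLocalHomeomorph_r : IsLocalHomeomorph (r : G → UnitSpace G)

/-- Ample groupoids: étale groupoids with zero-dimensional unit space. -/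
class IsAmple (G : Type*) [TopologicalSpace G] [ArrowGroupoid G] : Prop extends IsEtale G where
  zeroDimensional_units :
    TopologicalSpace.IsTopologicalBasis {C : Set (UnitSpace G) | IsClopen C}

/-- `G` is effective if the interior of its isotropy bundle is its unit space. -/
def Effective (G : Type*) [TopologicalSpace G] [ArrowGroupoid G] : Prop :=
  interior (Iso G) = {x : G | src x = x}

/-- `G` is strongly effective if its restriction to every closed invariant set of units is
effective. -/
def StronglyEffective (G : Type*) [TopologicalSpace G] [ArrowGroupoid G] : Prop :=
  ∀ (C : Set (UnitSpace G)) (hC : Invariant C), IsClosed C → Effective (restrict C hC).carrier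

end ArrowGroupoid

/-! ### The Steinberg algebra -/

/-- The `R`-module `C_c(X, R)` of locally constant, compactly supported functions `X → R`. -/
def CompactlySupportedLC (R X : Type*) [CommRing R] [TopologicalSpace X] :
    Submodule R (X → R) where
  carrier := {f | IsLocallyConstant f ∧ HasCompactSupport f}
  add_mem' hf hg := ⟨hf.1.add hg.1, hf.2.add hg.2⟩
  zero_mem' := ⟨IsLocallyConstant.const 0, HasCompactSupport.zero⟩
  smul_mem' a _ hf := ⟨hf.1.comp (fun x => a • x), hf.2.comp_left (smul_zero a)⟩

/-- The Steinberg algebra `A_R(G)`: the module `C_c(G, R)`, with the convolution product. -/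
def SteinbergAlgebra (R G : Type*) [CommRing R] [TopologicalSpace G] : Type _ :=
  CompactlySupportedLC R G

namespace SteinbergAlgebra

section Module

variable {R G : Type*} [CommRing R] [TopologicalSpace G]

instance : AddCommGroup (SteinbergAlgebra R G) :=
  inferInstanceAs (AddCommGroup (CompactlySupportedLC R G))

instance : Module R (SteinbergAlgebra R G) :=
  inferInstanceAs (Module R (CompactlySupportedLC R G))

instance : FunLike (SteinbergAlgebra R G) G R where
  coe f := (f : CompactlySupportedLC R G).1
  coe_injective _ _ h := Subtype.ext h

@[ext] lemma ext {f g : SteinbergAlgebra R G} (h : ∀ a, f a = g a) : f = g :=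
  DFunLike.ext f g h

@[simp] lemma zero_apply (a : G) : (0 : SteinbergAlgebra R G) a = 0 := rfl
@[simp] lemma add_apply (f g : SteinbergAlgebra R G) (a : G) : (f + g) a = f a + g a := rfl
@[simp] lemma neg_apply (f : SteinbergAlgebra R G) (a : G) : (-f) a = -f a := rfl
@[simp] lemma smul_apply (x : R) (f : SteinbergAlgebra R G) (a : G) : (x • f) a = x * f a := rfl

lemma sum_apply {ι : Type*} (t : Finset ι) (F : ι → SteinbergAlgebra R G) (a : G) :
    (∑ i ∈ t, F i) a = ∑ i ∈ t, F i a := by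
  classical
  induction t using Finset.induction_on with
  | empty => simp
  | insert i t hi ih => rw [Finset.sum_insert hi, Finset.sum_insert hi, add_apply, ih]

lemma isLocallyConstant (f : SteinbergAlgebra R G) : IsLocallyConstant f := f.2.1

lemma isClopen_support (f : SteinbergAlgebra R G) : IsClopen (Function.support f) :=
  f.isLocallyConstant.isClopen_fiber 0 |>.compl

lemma isCompact_support (f : SteinbergAlgebra R G) : IsCompact (Function.support f) := by
  have h : IsCompact (closure (Function.support f)) := f.2.2
  rwa [f.isClopen_support.1.closure_eq] at h

/-- An element of the Steinberg algebra from a locally constant function that vanishes outside a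
compact set. -/
def of [T2Space G] (f : G → R) (hf : IsLocallyConstant f) (C : Set G) (hC : IsCompact C)
    (h : ∀ a, a ∉ C → f a = 0) : SteinbergAlgebra R G :=
  ⟨f, hf, HasCompactSupport.intro hC (fun a ha => h a ha)⟩

@[simp] lemma of_apply [T2Space G] (f : G → R) (hf : IsLocallyConstant f) (C : Set G)
    (hC : IsCompact C) (h : ∀ a, a ∉ C → f a = 0) (a : G) : of f hf C hC h a = f a := rfl

end Module

end SteinbergAlgebra

/-- A function that is locally constant on an open set, vanishes outside it, and has closed
support, is locally constant. -/
lemma isLocallyConstant_of_restrict {X R : Type*} [TopologicalSpace X] [Zero R] {f : X → R}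
    {W : Set X} (hW : IsOpen W) (hf : IsLocallyConstant fun x : W => f x)
    (h0 : ∀ x, x ∉ W → f x = 0) (hs : IsClosed (Function.support f)) :
    IsLocallyConstant f := by
  refine (IsLocallyConstant.iff_eventually_eq f).2 fun x => ?_
  by_cases hx : f x = 0
  · filter_upwards [hs.isOpen_compl.mem_nhds (show x ∈ (Function.support f)ᶜ by simpa using hx)]
      with y hy
    rw [hx]; simpa using hy
  · have hxW : x ∈ W := by by_contra h; exact hx (h0 x h)
    have := (IsLocallyConstant.iff_eventually_eq _).1 hf ⟨x, hxW⟩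
    rw [nhds_subtype_eq_comap, Filter.eventually_comap] at this
    filter_upwards [this, hW.mem_nhds hxW] with y hy hyW
    exact hy ⟨y, hyW⟩ rfl

namespace SteinbergAlgebra

section Restrictions

variable {R G : Type*} [CommRing R] [TopologicalSpace G]

/-- The restriction of an element of `C_c(G, R)` to a clopen set, extended by zero. -/
noncomputable def cut (D : Set G) (hD : IsClopen D) :
    SteinbergAlgebra R G →ₗ[R] SteinbergAlgebra R G where
  toFun f := ⟨D.indicator f, by
    classical
    refine ⟨(IsLocallyConstant.iff_eventually_eq _).2 fun x => ?_, ?_⟩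
    · have hf := (IsLocallyConstant.iff_eventually_eq _).1 f.isLocallyConstant x
      by_cases hx : x ∈ D
      · filter_upwards [hf, hD.2.mem_nhds hx] with y hy hyD
        rw [Set.indicator_of_mem hx, Set.indicator_of_mem hyD, hy]
      · filter_upwards [hD.1.isOpen_compl.mem_nhds hx] with y hyD
        rw [Set.indicator_of_notMem hx, Set.indicator_of_notMem hyD]
    · exact f.2.2.mono (by
        intro x hx
        simp only [Function.mem_support] at hx ⊢
        intro h; apply hx
        by_cases hxD : x ∈ D
        · rw [Set.indicator_of_mem hxD]; exact h
        · exact Set.indicator_of_notMem hxD _)⟩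
  map_add' f g := by
    ext x; exact congrFun (Set.indicator_add D (⇑f) (⇑g)) x
  map_smul' a f := by
    ext x; exact congrFun (Set.indicator_const_smul D a (⇑f)) x

open Classical in
@[simp] lemma cut_apply (D : Set G) (hD : IsClopen D) (f : SteinbergAlgebra R G) (x : G) :
    cut D hD f x = if x ∈ D then f x else 0 := by
  show D.indicator f x = _
  rw [Set.indicator_apply]

/-- For an open subset `H` of `G`, the inclusion `C_c(H, R) → C_c(G, R)` given by extension by
zero.  When `H` is a subgroupoid it identifies `A_R(H)` with a subset of `A_R(G)`. -/
noncomputable def extendByZero [T2Space G] (H : Set G) (hH : IsOpen H) :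
    SteinbergAlgebra R H →ₗ[R] SteinbergAlgebra R G where
  toFun f := ⟨Function.extend Subtype.val f 0, by
    have hin : ∀ x : H, Function.extend Subtype.val f 0 (x : G) = f x :=
      fun x => Subtype.val_injective.extend_apply _ _ x
    have hout : ∀ x, x ∉ H → Function.extend Subtype.val (⇑f) 0 x = 0 := fun x hx =>
      Function.extend_apply' _ _ _ (by rintro ⟨y, rfl⟩; exact hx y.2)
    have hK : IsCompact (Subtype.val '' Function.support f) :=
      f.isCompact_support.image continuous_subtype_val
    have hsup : Function.support (Function.extend Subtype.val (⇑f) 0)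
        = Subtype.val '' Function.support f := by
      ext x
      constructor
      · intro hx
        have hxH : x ∈ H := by by_contra h; exact hx (hout x h)
        exact ⟨⟨x, hxH⟩, by simpa [hin ⟨x, hxH⟩] using hx, rfl⟩
      · rintro ⟨y, hy, rfl⟩
        simpa [hin y] using hy
    refine ⟨isLocallyConstant_of_restrict hH ?_ hout (hsup ▸ hK.isClosed), ?_⟩
    · simpa only [hin] using f.isLocallyConstant
    · exact HasCompactSupport.intro hK fun x hx => by
        by_contra h
        exact hx (hsup ▸ h)⟩
  map_add' f g := by
    ext x
    show Function.extend Subtype.val (⇑(f + g)) 0 x =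
      Function.extend Subtype.val (⇑f) 0 x + Function.extend Subtype.val (⇑g) 0 x
    by_cases hx : x ∈ H
    · lift x to H using hx
      simp only [Subtype.val_injective.extend_apply, add_apply]
    · have : ¬ ∃ y : H, (y : G) = x := by rintro ⟨y, rfl⟩; exact hx y.2
      simp [Function.extend_apply' _ _ _ this]
  map_smul' a f := by
    ext x
    show Function.extend Subtype.val (⇑(a • f)) 0 x = a * Function.extend Subtype.val (⇑f) 0 x
    by_cases hx : x ∈ H
    · lift x to H using hx
      simp only [Subtype.val_injective.extend_apply, smul_apply]
    · have : ¬ ∃ y : H, (y : G) = x := by rintro ⟨y, rfl⟩; exact hx y.2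
      simp [Function.extend_apply' _ _ _ this]

/-- The image of extension by zero consists of the elements vanishing outside `H`. -/
lemma mem_range_extendByZero [T2Space G] (H : Set G) (hH : IsOpen H) (f : SteinbergAlgebra R G) :
    f ∈ LinearMap.range (extendByZero (R := R) H hH) ↔ ∀ x, x ∉ H → f x = 0 := by
  constructor
  · rintro ⟨k, rfl⟩ x hx
    exact Function.extend_apply' _ _ _ (by rintro ⟨y, rfl⟩; exact hx y.2)
  · intro h0
    have hsub : Function.support f ⊆ H := fun x hx => by
      by_contra h; exact hx (h0 x h)
    have hK : IsCompact ((Subtype.val : H → G) ⁻¹' Function.support f) :=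
      Topology.IsInducing.subtypeVal.isCompact_preimage_iff (by simpa using hsub)
        |>.2 f.isCompact_support
    refine ⟨of (fun x : H => f x) (f.isLocallyConstant.comp_continuous continuous_subtype_val)
      _ hK (fun x hx => by simpa using hx), ?_⟩
    ext x
    show Function.extend Subtype.val (fun x : H => f x) 0 x = f x
    by_cases hx : x ∈ H
    · lift x to H using hx
      exact Subtype.val_injective.extend_apply _ _ x
    · rw [h0 x hx]
      exact Function.extend_apply' _ _ _ (by rintro ⟨y, rfl⟩; exact hx y.2)

end Restrictions

end SteinbergAlgebra

/-! ### Convolution -/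

namespace SteinbergAlgebra

open ArrowGroupoid

section Convolution

variable {R G : Type*} [CommRing R] [ArrowGroupoid G]

/-- The convolution of two functions on `G`:
the value at `γ` is the sum of `f a * g b` over all composable pairs with `a b = γ`. -/
noncomputable def conv (f g : G → R) (γ : G) : R :=
  ∑ᶠ p : {p : G × G // ∃ h : src p.1 = rng p.2, mul p.1 p.2 h = γ}, f p.1.1 * g p.1.2

/-- For `a` with the same range as `γ`, the arrow `a⁻¹ γ`. -/
def ldiv (γ : G) (a : {a : G // rng a = rng γ}) : G := mul (inv a.1) γ ((src_inv a.1).trans a.2)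

/-- Factorizations of `γ` correspond to arrows with the same range as `γ`. -/
def factorEquiv (γ : G) : {p : G × G // ∃ h : src p.1 = rng p.2, mul p.1 p.2 h = γ} ≃
    {a : G // rng a = rng γ} where
  toFun p := ⟨p.1.1, by
    obtain ⟨h, h'⟩ := p.2
    exact (rng_mul _ _ h).symm.trans (congrArg rng h')⟩
  invFun a := ⟨(a.1, ldiv γ a), by simp [ldiv, rng_mul, rng_inv],
    mul_inv_cancel_left _ _ a.2 (by simp [rng_mul, rng_inv])⟩
  left_inv p := by
    obtain ⟨⟨a, b⟩, h, h'⟩ := p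
    subst h'
    apply Subtype.ext
    simp only [ldiv, Prod.mk.injEq, true_and]
    exact inv_mul_cancel_left a b h _
  right_inv a := rfl

lemma conv_eq (f g : G → R) (γ : G) :
    conv f g γ = ∑ᶠ a : {a : G // rng a = rng γ}, f a.1 * g (ldiv γ a) := by
  rw [conv, ← finsum_comp_equiv (factorEquiv γ).symm]
  rfl

/-- Arrows with the same range as `γ` correspond to arrows with the same range as `b⁻¹ γ`. -/
def shiftEquiv (γ : G) (b : {a : G // rng a = rng γ}) :
    {a : G // rng a = rng γ} ≃ {a : G // rng a = rng (ldiv γ b)} where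
  toFun a := ⟨ldiv a.1 ⟨b.1, b.2.trans a.2.symm⟩, by simp [ldiv, rng_mul]⟩
  invFun d := ⟨mul b.1 d.1 (by rw [d.2, ldiv, rng_mul, rng_inv]), by rw [rng_mul, b.2]⟩
  left_inv a := Subtype.ext (mul_inv_cancel_left _ _ (b.2.trans a.2.symm) _)
  right_inv d := Subtype.ext (inv_mul_cancel_left _ _ _ _)

lemma inv_mul_rev (a b : G) (h : src a = rng b) :
    inv (mul a b h) = mul (inv b) (inv a) (by rw [src_inv, rng_inv, h]) := by
  have hr : src (inv b) = rng (inv a) := by rw [src_inv, rng_inv, h]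
  have key : mul (mul a b h) (mul (inv b) (inv a) hr) (by rw [src_mul, rng_mul, rng_inv])
      = rng (mul a b h) := by
    rw [ArrowGroupoid.mul_assoc a b _ h (by rw [rng_mul, rng_inv])]
    rw [mul_congr rfl (show mul b (mul (inv b) (inv a) hr) (by rw [rng_mul, rng_inv]) = inv a from
      mul_inv_cancel_left b (inv a) (by rw [rng_inv, h]) _) _ (rng_inv a).symm, ArrowGroupoid.mul_inv, rng_mul]
  have h2 := inv_mul_cancel_left (mul a b h) (mul (inv b) (inv a) hr)
    (by rw [src_mul, rng_mul, rng_inv]) (by rw [src_inv, rng_mul (mul a b h)])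
  rw [mul_congr rfl (key.trans (src_inv _).symm) _ (rng_src _).symm, mul_src] at h2
  exact h2

lemma ldiv_shift (γ : G) (b a : {a : G // rng a = rng γ}) :
    ldiv (ldiv γ b) (shiftEquiv γ b a) = ldiv γ a := by
  have e : (shiftEquiv γ b a).1 = mul (inv b.1) a.1 ((src_inv _).trans (b.2.trans a.2.symm)) := rfl
  have h1 : src (inv a.1) = rng b.1 := by rw [src_inv, a.2, b.2]
  have e2 : inv (shiftEquiv γ b a).1 = mul (inv a.1) b.1 h1 := by
    rw [e, inv_mul_rev]; exact mul_congr rfl (ArrowGroupoid.inv_inv _) _ _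
  have e3 : src (mul (inv a.1) b.1 h1) = rng (ldiv γ b) := by
    rw [src_mul, ldiv, rng_mul, rng_inv]
  calc ldiv (ldiv γ b) (shiftEquiv γ b a) = mul (mul (inv a.1) b.1 h1) (ldiv γ b) e3 :=
        mul_congr e2 rfl _ _
    _ = mul (inv a.1) (mul b.1 (ldiv γ b) ((src_mul _ _ _).symm.trans e3)) _ :=
        ArrowGroupoid.mul_assoc _ _ _ h1 ((src_mul _ _ _).symm.trans e3)
    _ = ldiv γ a := mul_congr rfl (mul_inv_cancel_left b.1 γ b.2 _) _ _

end Convolution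

section ConvolutionTopology

variable {R G : Type*} [CommRing R] [TopologicalSpace G] [ArrowGroupoid G]

lemma continuous_r [IsAmple G] : Continuous (r : G → UnitSpace G) :=
  IsEtale.isLocalHomeomorph_r.continuous

lemma continuous_rng [IsAmple G] : Continuous (rng : G → G) :=
  continuous_subtype_val.comp continuous_r

lemma continuous_src [IsAmple G] : Continuous (src : G → G) := by
  have : (src : G → G) = rng ∘ inv := by ext a; simp [rng_inv]
  rw [this]; exact continuous_rng.comp IsEtale.continuous_inv

lemma exists_compact_bisection [IsAmple G] (K : Set G) (hKo : IsOpen K) (a : G) (ha : a ∈ K) :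
    ∃ D : Set G, IsCompact D ∧ IsOpen D ∧ a ∈ D ∧ D ⊆ K ∧
      Set.InjOn (r : G → UnitSpace G) D := by
  obtain ⟨e, hae, he⟩ := (IsEtale.isLocalHomeomorph_r (G := G)) a
  have : LocallyCompactSpace (UnitSpace G) := IsEtale.locallyCompact_units
  have hO : IsOpen (e '' (e.source ∩ K)) :=
    e.isOpen_image_of_subset_source (e.open_source.inter hKo) Set.inter_subset_left
  have haO : e a ∈ e '' (e.source ∩ K) := ⟨a, ⟨hae, ha⟩, rfl⟩
  obtain ⟨L, hL, haL, hLO⟩ := exists_compact_subset hO haO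
  obtain ⟨V, hV, haV, hVL⟩ := (IsAmple.zeroDimensional_units (G := G)).exists_subset_of_mem_open
    haL isOpen_interior
  have hVc : IsCompact V := hL.of_isClosed_subset hV.1 (hVL.trans interior_subset)
  have hVO : V ⊆ e '' (e.source ∩ K) := (hVL.trans interior_subset).trans hLO
  have hVt : V ⊆ e.target := hVO.trans (by
    rintro _ ⟨b, hb, rfl⟩; exact e.map_source hb.1)
  refine ⟨e.symm '' V, hVc.image_of_continuousOn (e.continuousOn_symm.mono hVt),
    e.symm.isOpen_image_of_subset_source hV.2 hVt, ⟨e a, haV, e.left_inv hae⟩, ?_, ?_⟩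
  · rintro _ ⟨v, hv, rfl⟩
    obtain ⟨b, hb, rfl⟩ := hVO hv
    rw [e.left_inv hb.1]; exact hb.2
  · rintro _ ⟨v, hv, rfl⟩ _ ⟨w, hw, rfl⟩ h
    rw [he, e.right_inv (hVt hv), e.right_inv (hVt hw)] at h
    rw [h]

variable [T2Space G] [IsAmple G]

lemma finite_fibre (K : Set G) (hK : IsCompact K) (u : G) : {a ∈ K | rng a = u}.Finite := by
  have hcl : IsClosed {a : G | rng a = u} := isClosed_eq continuous_rng continuous_const
  have hc : IsCompact {a ∈ K | rng a = u} := hK.inter_right hcl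
  refine hc.finite (isDiscrete_iff_forall_mem_exists_isOpen.2 fun a ha => ?_)
  obtain ⟨e, hae, he⟩ := (IsEtale.isLocalHomeomorph_r (G := G)) a
  refine ⟨e.source, e.open_source, ?_⟩
  ext b
  constructor
  · rintro ⟨hb, hb'⟩
    refine e.injOn hb hae ?_
    rw [← he]
    exact Subtype.ext (hb'.2.trans ha.2.symm)
  · rintro rfl; exact ⟨hae, ha⟩

lemma finite_support_conv (f : SteinbergAlgebra R G) (γ : G)
    (k : {a : G // rng a = rng γ} → R) :
    (Function.support fun a : {a : G // rng a = rng γ} => f a.1 * k a).Finite := by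
  refine Set.Finite.of_finite_image (f := Subtype.val)
    ((finite_fibre _ f.isCompact_support (rng γ)).subset ?_) Subtype.val_injective.injOn
  rintro _ ⟨a, ha, rfl⟩
  exact ⟨fun h => ha (by simp [h]), a.2⟩

lemma conv_add_left (f f' g : SteinbergAlgebra R G) (γ : G) :
    conv (f + f' : SteinbergAlgebra R G) g γ = conv f g γ + conv f' g γ := by
  simp only [conv_eq, add_apply, add_mul]
  exact finsum_add_distrib (finite_support_conv f γ _) (finite_support_conv f' γ _)

lemma conv_add_right (f g g' : SteinbergAlgebra R G) (γ : G) :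
    conv f (g + g' : SteinbergAlgebra R G) γ = conv f g γ + conv f g' γ := by
  simp only [conv_eq, add_apply, mul_add]
  exact finsum_add_distrib (finite_support_conv f γ _) (finite_support_conv f γ _)

lemma conv_support (f g : SteinbergAlgebra R G) : ∃ C : Set G, IsCompact C ∧
    ∀ γ, γ ∉ C → conv f g γ = 0 := by
  have hcl : IsClosed {p : G × G | src p.1 = rng p.2} :=
    isClosed_eq (continuous_src.comp continuous_fst) (continuous_rng.comp continuous_snd)
  have hc : IsCompact ((Subtype.val : {p : G × G // src p.1 = rng p.2} → G × G) ⁻¹'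
      (Function.support f ×ˢ Function.support g)) :=
    hcl.isClosedEmbedding_subtypeVal.isCompact_preimage
      (f.isCompact_support.prod g.isCompact_support)
  refine ⟨_, hc.image IsEtale.continuous_mul, fun γ hγ => ?_⟩
  refine finsum_eq_zero_of_forall_eq_zero fun p => ?_
  obtain ⟨⟨a, b⟩, h, h'⟩ := p
  by_contra hne
  exact hγ ⟨⟨(a, b), h⟩, ⟨fun h0 => hne (by simp [h0]), fun h0 => hne (by simp [h0])⟩, h'⟩

/-- Local constancy of a convolution when the first factor lives on a compact open set on which
the range map is injective. -/
lemma conv_lc_of_injOn (f g : SteinbergAlgebra R G) (D : Set G) (hD : IsCompact D)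
    (hDo : IsOpen D) (hinj : Set.InjOn (r : G → UnitSpace G) D) (hfD : ∀ a, a ∉ D → f a = 0) :
    IsLocallyConstant (conv f g) := by
  have hemb : Topology.IsOpenEmbedding (fun a : D => r a.1) :=
    .of_continuous_injective_isOpenMap (continuous_r.comp continuous_subtype_val)
      (fun a b h => Subtype.ext (hinj a.2 b.2 h))
      (IsEtale.isLocalHomeomorph_r.isOpenMap.comp hDo.isOpenMap_subtype_val)
  let W : Set G := r ⁻¹' Set.range (fun a : D => r a.1)
  have hWo : IsOpen W := hemb.isOpen_range.preimage continuous_r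
  have hWc : IsClosed W := by
    have : CompactSpace D := isCompact_iff_compactSpace.1 hD
    exact (isCompact_range hemb.continuous).isClosed.preimage continuous_r
  have h0 : ∀ γ, γ ∉ W → conv f g γ = 0 := by
    intro γ hγ
    rw [conv_eq]
    refine finsum_eq_zero_of_forall_eq_zero fun a => ?_
    rw [hfD a.1 (fun ha => hγ ⟨⟨a.1, ha⟩, Subtype.ext a.2⟩), zero_mul]
  let σ := hemb.isEmbedding.toHomeomorph.symm
  let α : W → D := fun γ => σ ⟨r γ.1, γ.2⟩
  have hα : Continuous α :=
    σ.continuous.comp ((continuous_r.comp continuous_subtype_val).subtype_mk _)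
  have hrα : ∀ γ : W, rng (α γ).1 = rng γ.1 := fun γ =>
    congrArg (fun x => (x : UnitSpace G).1)
      (congrArg Subtype.val (hemb.isEmbedding.toHomeomorph.apply_symm_apply ⟨r γ.1, γ.2⟩))
  let β : W → G := fun γ => ldiv γ.1 ⟨(α γ).1, hrα γ⟩
  have hβ : Continuous β := by
    have h1 : Continuous fun γ : W => ((inv (α γ).1, γ.1) : G × G) :=
      (IsEtale.continuous_inv.comp (continuous_subtype_val.comp hα)).prodMk
        continuous_subtype_val
    have h2 : ∀ γ : W, src (inv (α γ).1) = rng γ.1 := fun γ => (src_inv _).trans (hrα γ)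
    exact (IsEtale.continuous_mul (G := G)).comp
      (h1.subtype_mk (p := fun p : G × G => src p.1 = rng p.2) h2)
  have hval : ∀ γ : W, conv f g γ = f (α γ).1 * g (β γ) := by
    intro γ
    rw [conv_eq]
    refine finsum_eq_single _ (⟨(α γ).1, hrα γ⟩ : {a : G // rng a = rng γ.1}) fun a ha => ?_
    rw [hfD a.1 (fun haD => ha ?_), zero_mul]
    exact Subtype.ext (hinj haD (α γ).2 (Subtype.ext (a.2.trans (hrα γ).symm)))
  have hlc : IsLocallyConstant fun γ : W => conv f g γ := by
    simp only [hval]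
    exact (f.isLocallyConstant.comp_continuous (continuous_subtype_val.comp hα)).mul
      (g.isLocallyConstant.comp_continuous hβ)
  refine (IsLocallyConstant.iff_eventually_eq _).2 fun x => ?_
  by_cases hx : x ∈ W
  · have := (IsLocallyConstant.iff_eventually_eq _).1 hlc ⟨x, hx⟩
    rw [nhds_subtype_eq_comap, Filter.eventually_comap] at this
    filter_upwards [this, hWo.mem_nhds hx] with y hy hyW
    exact hy ⟨y, hyW⟩ rfl
  · filter_upwards [hWc.isOpen_compl.mem_nhds hx] with y hy
    rw [h0 x hx, h0 y hy]

lemma conv_lc (f g : SteinbergAlgebra R G) : IsLocallyConstant (conv f g) := by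
  classical
  have key : ∀ (t : Set (Set G)), t.Finite →
      (∀ D ∈ t, IsCompact D ∧ IsOpen D ∧ Set.InjOn (r : G → UnitSpace G) D) →
      ∀ f : SteinbergAlgebra R G, Function.support f ⊆ ⋃₀ t → IsLocallyConstant (conv f g) := by
    intro t ht
    induction t, ht using Set.Finite.induction_on with
    | empty =>
      intro _ f hf
      have : f = 0 := by
        ext a; by_contra h; simpa using hf h
      subst this
      have : conv (0 : SteinbergAlgebra R G) g = fun _ => (0 : R) := by
        ext γ; simp [conv]
      rw [this]; exact IsLocallyConstant.const 0
    | @insert D t _ _ ih =>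
      intro hD f hf
      obtain ⟨hDc, hDo, hDi⟩ := hD D (Set.mem_insert _ _)
      have hcl : IsClopen D := ⟨hDc.isClosed, hDo⟩
      have hsplit : f = cut D hcl f + cut Dᶜ hcl.compl f := by
        ext a; by_cases ha : a ∈ D <;> simp [ha]
      have : conv f g = conv (cut D hcl f) g + conv (cut Dᶜ hcl.compl f) g := by
        ext γ
        conv_lhs => rw [hsplit]
        exact conv_add_left _ _ _ _
      rw [this]
      refine (conv_lc_of_injOn _ g D hDc hDo hDi fun a ha => by simp [ha]).add
        (ih (fun E hE => hD E (Set.mem_insert_of_mem _ hE)) _ fun a ha => ?_)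
      by_cases haD : a ∈ D
      · exact absurd (by simp [haD]) ha
      · have : f a ≠ 0 := by simpa [haD] using ha
        simpa [haD] using hf this
  choose! D hDc hDo haD _ hDi using exists_compact_bisection (Function.support f) f.isClopen_support.2
  obtain ⟨t, ht, hcov⟩ := f.isCompact_support.elim_nhds_subcover D
    (fun a ha => (hDo a ha).mem_nhds (haD a ha))
  refine key (D '' t) (t.finite_toSet.image _) ?_ f ?_
  · rintro _ ⟨a, ha, rfl⟩
    exact ⟨hDc a (ht a ha), hDo a (ht a ha), hDi a (ht a ha)⟩
  · simpa using hcov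

noncomputable instance : Mul (SteinbergAlgebra R G) where
  mul f g := ⟨conv f g, conv_lc f g, by
    obtain ⟨C, hC, h⟩ := conv_support f g
    exact HasCompactSupport.intro hC h⟩

/-- The product of the Steinberg algebra is convolution. -/
lemma mul_apply (f g : SteinbergAlgebra R G) (γ : G) : (f * g) γ = conv f g γ := rfl

lemma conv_assoc (f g h : SteinbergAlgebra R G) : f * g * h = f * (g * h) := by
  ext γ
  have hA := finite_support_conv (f * g) γ fun a => h (ldiv γ a)
  have hB := finite_fibre _ f.isCompact_support (rng γ)
  let B : Set {a : G // rng a = rng γ} := Function.support fun b => f b.1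
  have hBf : B.Finite := by simpa using finite_support_conv f γ fun _ => (1 : R)
  -- the arrows `a = b d` with `b` in the support of `f` and `d` in the support of `g`
  let A : Set {a : G // rng a = rng γ} :=
    ⋃ b ∈ B, (shiftEquiv γ b) ⁻¹' (Function.support fun d => g d.1)
  have hAf : A.Finite := hBf.biUnion fun b _ =>
    Set.Finite.preimage (shiftEquiv γ b).injective.injOn
      (by simpa using finite_support_conv g (ldiv γ b) fun _ => (1 : R))
  have h1 : ∀ a : {a : G // rng a = rng γ}, (f * g) a.1 =
      ∑ b ∈ hBf.toFinset, f b.1 * g (shiftEquiv γ b a).1 := by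
    intro a
    rw [mul_apply, conv_eq]
    let e : {b : G // rng b = rng a.1} ≃ {b : G // rng b = rng γ} :=
      Equiv.subtypeEquivRight fun b => by rw [a.2]
    rw [← finsum_comp_equiv e.symm]
    refine finsum_eq_sum_of_support_subset _ fun b hb => ?_
    simp only [Set.Finite.coe_toFinset]
    exact fun h0 => hb (by
      show f b.1 * _ = 0
      rw [show f b.1 = 0 from h0, zero_mul])
  have h2 : ∀ b : {a : G // rng a = rng γ}, b ∈ B → (g * h) (ldiv γ b) =
      ∑ a ∈ hAf.toFinset, g (shiftEquiv γ b a).1 * h (ldiv γ a) := by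
    intro b hb
    rw [mul_apply, conv_eq, ← finsum_comp_equiv (shiftEquiv γ b)]
    simp only [ldiv_shift]
    refine finsum_eq_sum_of_support_subset _ fun a ha => ?_
    simp only [Set.Finite.coe_toFinset]
    refine Set.mem_biUnion hb fun h0 => ha ?_
    show g _ * _ = 0
    rw [show g (shiftEquiv γ b a).1 = 0 from h0, zero_mul]
  have hL : (f * g * h) γ = ∑ a ∈ hAf.toFinset, (f * g) a.1 * h (ldiv γ a) := by
    rw [mul_apply, conv_eq]
    refine finsum_eq_sum_of_support_subset _ fun a ha => ?_
    simp only [Set.Finite.coe_toFinset]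
    by_contra hn
    refine ha ?_
    show (f * g) a.1 * _ = 0
    rw [h1, Finset.sum_eq_zero, zero_mul]
    intro b hb
    have hb' : b ∈ B := by simpa using hb
    have : g (shiftEquiv γ b a).1 = 0 := by
      by_contra h0
      exact hn (Set.mem_biUnion hb' h0)
    rw [this, mul_zero]
  have hR : (f * (g * h)) γ = ∑ b ∈ hBf.toFinset, f b.1 * (g * h) (ldiv γ b) := by
    rw [mul_apply, conv_eq]
    refine finsum_eq_sum_of_support_subset _ fun b hb => ?_
    simp only [Set.Finite.coe_toFinset]
    exact fun h0 => hb (by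
      show f b.1 * _ = 0
      rw [show f b.1 = 0 from h0, zero_mul])
  rw [hL, hR]
  simp only [h1, Finset.sum_mul]
  rw [Finset.sum_comm]
  refine Finset.sum_congr rfl fun b hb => ?_
  rw [h2 b (by simpa using hb), Finset.mul_sum]
  exact Finset.sum_congr rfl fun a _ => _root_.mul_assoc _ _ _

noncomputable instance : NonUnitalRing (SteinbergAlgebra R G) where
  left_distrib f g h := by ext γ; exact conv_add_right f g h γ
  right_distrib f g h := by ext γ; exact conv_add_left f g h γ
  zero_mul f := by ext γ; simp [mul_apply, conv]
  mul_zero f := by ext γ; simp [mul_apply, conv]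
  mul_assoc := conv_assoc

instance : IsScalarTower R (SteinbergAlgebra R G) (SteinbergAlgebra R G) where
  smul_assoc x f g := by
    ext γ
    simp only [smul_eq_mul, mul_apply, smul_apply, conv_eq, _root_.mul_assoc]
    exact (smul_finsum' x (finite_support_conv f γ _)).symm

instance : SMulCommClass R (SteinbergAlgebra R G) (SteinbergAlgebra R G) where
  smul_comm x f g := by
    ext γ
    simp only [smul_eq_mul, mul_apply, smul_apply, conv_eq, mul_left_comm _ x]
    exact smul_finsum' x (finite_support_conv f γ _)

end ConvolutionTopology

end SteinbergAlgebra

/-! ### Gradings and graded ideals -/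

/-- A locally constant cocycle on `G` with values in the (discrete) group `Γ`. -/
structure LCCocycle (G Γ : Type*) [TopologicalSpace G] [ArrowGroupoid G] [Group Γ] where
  toFun : G → Γ
  isCocycle : ArrowGroupoid.IsCocycle toFun
  isLocallyConstant : IsLocallyConstant toFun

namespace LCCocycle

variable {G Γ : Type*} [TopologicalSpace G] [ArrowGroupoid G] [Group Γ]

/-- The subgroupoid `c⁻¹(e)` of `G`. -/
abbrev kernel (c : LCCocycle G Γ) : ArrowGroupoid.Sub G :=
  ArrowGroupoid.kernel c.toFun c.isCocycle

lemma isClopen_fibre (c : LCCocycle G Γ) (g : Γ) : IsClopen (c.toFun ⁻¹' {g}) :=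
  c.isLocallyConstant.isClopen_fiber g

end LCCocycle

namespace SteinbergAlgebra

section Grading

variable {R G Γ : Type*} [CommRing R] [TopologicalSpace G] [ArrowGroupoid G] [Group Γ]

/-- The homogeneous submodule of degree `g`: the elements vanishing outside `c⁻¹(g)`. -/
def homogeneous (R : Type*) [CommRing R] (c : LCCocycle G Γ) (g : Γ) :
    Submodule R (SteinbergAlgebra R G) where
  carrier := {f | ∀ a, c.toFun a ≠ g → f a = 0}
  add_mem' hf hk a ha := by rw [add_apply, hf a ha, hk a ha, add_zero]
  zero_mem' _ _ := rfl
  smul_mem' x f hf a ha := by rw [smul_apply, hf a ha, mul_zero]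

/-- The projection onto the homogeneous submodule of degree `g`. -/
noncomputable def component (c : LCCocycle G Γ) (g : Γ) :
    SteinbergAlgebra R G →ₗ[R] SteinbergAlgebra R G :=
  cut (c.toFun ⁻¹' {g}) (c.isClopen_fibre g)

open Classical in
@[simp] lemma component_apply (c : LCCocycle G Γ) (g : Γ) (f : SteinbergAlgebra R G) (a : G) :
    component c g f a = if c.toFun a = g then f a else 0 :=
  cut_apply _ _ f a

lemma component_mem (c : LCCocycle G Γ) (g : Γ) (f : SteinbergAlgebra R G) :
    component c g f ∈ homogeneous R c g := fun a ha => by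
  rw [component_apply, if_neg ha]

lemma component_of_mem (c : LCCocycle G Γ) {g : Γ} {f : SteinbergAlgebra R G}
    (hf : f ∈ homogeneous R c g) : component c g f = f := by
  ext a
  by_cases ha : c.toFun a = g
  · simp [ha]
  · simp [ha, hf a ha]

lemma component_of_mem_of_ne (c : LCCocycle G Γ) {g k : Γ} (hgk : g ≠ k)
    {f : SteinbergAlgebra R G} (hf : f ∈ homogeneous R c k) : component c g f = 0 := by
  ext a
  by_cases ha : c.toFun a = g
  · simp [ha, hf a (fun h => hgk (ha.symm.trans h))]
  · simp [ha]

lemma finite_degrees (c : LCCocycle G Γ) (f : SteinbergAlgebra R G) :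
    (c.toFun '' Function.support f).Finite := by
  let : TopologicalSpace Γ := ⊥
  have : DiscreteTopology Γ := ⟨rfl⟩
  exact (f.isCompact_support.image c.isLocallyConstant.continuous).finite_of_discrete

/-- An element is the sum of its homogeneous components. -/
lemma sum_component (c : LCCocycle G Γ) (f : SteinbergAlgebra R G) :
    ∑ g ∈ (finite_degrees c f).toFinset, component c g f = f := by
  classical
  ext a
  rw [sum_apply]
  simp only [component_apply, Finset.sum_ite_eq]
  split_ifs with h
  · rfl
  · by_contra hne
    exact h (by simpa using ⟨a, fun h0 => hne h0.symm, rfl⟩)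

open Classical in
/-- For a subgroup that contains the homogeneous components of its elements, and only for such a
subgroup, the intersections with the homogeneous submodules form a direct sum decomposition. -/
lemma isInternal_iff (c : LCCocycle G Γ) (J : AddSubgroup (SteinbergAlgebra R G)) :
    DirectSum.IsInternal (fun g : Γ => (homogeneous R c g).toAddSubgroup.comap J.subtype) ↔
      ∀ f ∈ J, ∀ g, component c g f ∈ J := by
  let B : Γ → AddSubgroup J := fun g => (homogeneous R c g).toAddSubgroup.comap J.subtype
  have hcomp : ∀ (x : DirectSum Γ fun g => B g) (g : Γ),
      component c g ((DirectSum.coeAddMonoidHom B x : J) : SteinbergAlgebra R G)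
        = ((x g : J) : SteinbergAlgebra R G) := by
    intro x g
    induction x using DirectSum.induction_on with
    | zero => simp
    | of k y =>
      rw [DirectSum.coeAddMonoidHom_of]
      by_cases h : g = k
      · subst h
        rw [DirectSum.of_eq_same]
        exact component_of_mem c y.2
      · rw [DirectSum.of_eq_of_ne _ _ _ h]
        exact component_of_mem_of_ne c h y.2
    | add x y hx hy =>
      rw [map_add, AddSubgroup.coe_add, map_add, hx, hy]; rfl
  constructor
  · intro h f hf g
    obtain ⟨x, hx⟩ := h.2 ⟨f, hf⟩
    have := hcomp x g
    rw [hx] at this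
    rw [this]
    exact (x g : J).2
  · intro h
    refine ⟨fun x y hxy => ?_, fun f => ?_⟩
    · refine DFinsupp.ext fun g => Subtype.ext (Subtype.ext ?_)
      rw [← hcomp x g, ← hcomp y g]
      exact congrArg (fun z : J => component c g (z : SteinbergAlgebra R G)) hxy
    · refine ⟨∑ g ∈ (finite_degrees c f.1).toFinset,
        DirectSum.of (fun g => B g) g ⟨⟨component c g f.1, h f.1 f.2 g⟩, component_mem c g f.1⟩, ?_⟩
      rw [map_sum]
      refine Subtype.ext ?_
      rw [AddSubgroup.val_finsetSum]
      exact (Finset.sum_congr rfl fun g _ =>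
        congrArg Subtype.val (DirectSum.coeAddMonoidHom_of B g _)).trans (sum_component c f.1)

variable [T2Space G] [ArrowGroupoid.IsAmple G]

/-- The homogeneous submodules are compatible with the product. -/
lemma homogeneous_mul_mem (c : LCCocycle G Γ) (g k : Γ) (f f' : SteinbergAlgebra R G)
    (hf : f ∈ homogeneous R c g) (hf' : f' ∈ homogeneous R c k) :
    f * f' ∈ homogeneous R c (g * k) := by
  intro a ha
  rw [mul_apply]
  refine finsum_eq_zero_of_forall_eq_zero fun p => ?_
  obtain ⟨⟨x, y⟩, h, h'⟩ := p
  by_cases hx : c.toFun x = g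
  · by_cases hy : c.toFun y = k
    · exact absurd (by rw [← h', c.isCocycle, hx, hy]) ha
    · simp [hf' y hy]
  · simp [hf x hx]

open Classical in
/-- An ideal `J` is graded if it is the direct sum of its intersections with the homogeneous
submodules. -/
def IsGraded (c : LCCocycle G Γ) (J : TwoSidedIdeal (SteinbergAlgebra R G)) : Prop :=
  DirectSum.IsInternal (fun g : Γ =>
    (homogeneous R c g).toAddSubgroup.comap (AddSubgroup.ofClass J).subtype)

lemma isGraded_iff (c : LCCocycle G Γ) (J : TwoSidedIdeal (SteinbergAlgebra R G)) :
    IsGraded c J ↔ ∀ f ∈ J, ∀ g, component c g f ∈ J :=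
  isInternal_iff c (AddSubgroup.ofClass J)

/-- The graded ideals of the Steinberg algebra, ordered by inclusion. -/
abbrev GradedIdeal (R : Type*) [CommRing R] (c : LCCocycle G Γ) : Type _ :=
  {J : TwoSidedIdeal (SteinbergAlgebra R G) // IsGraded c J}

/-- Graded ideals form a lattice, the join being the sum and the meet the intersection. -/
noncomputable instance (c : LCCocycle G Γ) : Lattice (GradedIdeal R c) :=
  Subtype.lattice
    (fun I J hI hJ => (isGraded_iff c _).2 fun f hf g => by
      obtain ⟨x, hx, y, hy, rfl⟩ := TwoSidedIdeal.mem_sup.1 hf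
      rw [map_add]
      exact TwoSidedIdeal.mem_sup.2 ⟨_, (isGraded_iff c I).1 hI x hx g, _,
        (isGraded_iff c J).1 hJ y hy g, rfl⟩)
    (fun I J hI hJ => (isGraded_iff c _).2 fun f hf g =>
      (TwoSidedIdeal.mem_inf _).2 ⟨(isGraded_iff c I).1 hI f ((TwoSidedIdeal.mem_inf _).1 hf).1 g,
        (isGraded_iff c J).1 hJ f ((TwoSidedIdeal.mem_inf _).1 hf).2 g⟩)

end Grading

section Restriction

variable {G : Type*} [TopologicalSpace G] [ArrowGroupoid G]

variable (G) in
/-- The open invariant subsets of the unit space, ordered by inclusion. -/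
abbrev OpenInvariant : Type _ :=
  {U : TopologicalSpace.Opens (ArrowGroupoid.UnitSpace G) //
    ArrowGroupoid.Invariant (U : Set (ArrowGroupoid.UnitSpace G))}

/-- Open invariant sets form a lattice, under union and intersection. -/
instance : Lattice (OpenInvariant G) :=
  Subtype.lattice (fun _ _ hU hV a => or_congr (hU a) (hV a))
    (fun _ _ hU hV a => and_congr (hU a) (hV a))

/-- The restriction `G|_U` to an open invariant set `U` of units. -/
abbrev OpenInvariant.restrict (U : OpenInvariant G) : ArrowGroupoid.Sub G :=
  ArrowGroupoid.restrict (U.1 : Set (ArrowGroupoid.UnitSpace G)) U.2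

lemma OpenInvariant.isOpen_restrict [ArrowGroupoid.IsAmple G] (U : OpenInvariant G) : IsOpen U.restrict.carrier :=
  U.1.isOpen.preimage continuous_r

variable [T2Space G] [ArrowGroupoid.IsAmple G]

/-- The algebra `A_R(G|_U)`, seen inside `A_R(G)` by extension by zero. -/
noncomputable def ofRestrict (R : Type*) [CommRing R] (U : OpenInvariant G) :
    Submodule R (SteinbergAlgebra R G) :=
  LinearMap.range (extendByZero (R := R) U.restrict.carrier U.isOpen_restrict)

end Restriction

end SteinbergAlgebra

/-! An ideal is recovered from its elements supported on the unit space. To an ideal `J` attach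
`unitSupport J`, the set of units where some such element of `J` is nonzero. This set is open,
because elements are locally constant. It is invariant, because conjugating a unit-supported element
by the characteristic function of a compact open bisection carries its values from sources to ranges
(`r_mem_unitSupport`). The claim is that `J` is the ideal of functions living over this set.

One inclusion holds for every ideal (`restrictIdeal_openSupport_le`). Since `K` is a field, `J`
contains the characteristic function of a compact open neighbourhood of each unit in the support.
Finitely many of these act as local units for a given function living over the support.

The other inclusion uses the grading and strong effectivity. Let `C` be the closed invariant
complement of the support, and let `f` in `J` have degree `1` with `f x ≠ 0` at a unit `x` of `C`.
Effectivity of the kernel over `C` gives a small open set `N` of units meeting `C`, on which `f` is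
constant and such that no non-unit arrow of the support of `f` over `C` joins two points of `N`
(`exists_open_separating`). Compressing `f` to a compact open `V` inside `N` yields `f x` times the
characteristic function of `V`, up to an error living over the support. By the first inclusion the
error is in `J`, so a point of `V ∩ C` lies in the support, a contradiction.

For a graded ideal, the value of `f` at an arbitrary arrow `a` outside is moved to the unit at its
source: take the component of degree `c a`, which is still in `J`, and multiply by a bisection of
degree `(c a)⁻¹` through the inverse of `a`. The product has degree `1`, so the previous case
applies (`le_restrictIdeal_openSupport`). -/

namespace ArrowGroupoid

/-! ### Identities for units, ranges and sources. -/

section Algebraic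

variable {G : Type*} [ArrowGroupoid G]

lemma rng_of_src_eq {x : G} (h : src x = x) : rng x = x := by
  rw [← h, rng_src]

lemma inv_of_src_eq {x : G} (h : src x = x) : inv x = x := by
  have h1 := mul_inv x
  have h2 := rng_mul_self (inv x)
  rw [mul_congr (show rng (inv x) = x by rw [rng_inv, h]) rfl _ (rng_inv x).symm, h1] at h2
  rw [← h2, rng_of_src_eq h]

lemma r_eq_iff {a b : G} : r a = r b ↔ rng a = rng b := Subtype.ext_iff

lemma r_inv (a : G) : r (inv a) = s a := Subtype.ext (rng_inv a)

lemma s_inv (a : G) : s (inv a) = r a := Subtype.ext (src_inv a)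

lemma r_coe (x : UnitSpace G) : r (x : G) = x := Subtype.ext (rng_of_src_eq x.2)

end Algebraic

/-! ### Open units and compact open bisections. -/

section Topological

variable {G : Type*} [TopologicalSpace G] [ArrowGroupoid G]

open SteinbergAlgebra (continuous_r continuous_rng continuous_src exists_compact_bisection)

lemma continuous_s [IsAmple G] : Continuous (s : G → UnitSpace G) :=
  continuous_src.subtype_mk _

/-- The unit space of an étale groupoid is open. -/
lemma isOpen_units [IsAmple G] : IsOpen {x : G | src x = x} := by
  refine isOpen_iff_mem_nhds.2 fun x hx => ?_
  obtain ⟨e, hxe, he⟩ := (IsEtale.isLocalHomeomorph_r (G := G)) x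
  have hx' : rng x ∈ e.source := by rwa [rng_of_src_eq hx]
  -- Near `x`, both `a` and `rng a` lie in a set on which the range map is injective. They have the
  -- same range, so they coincide.
  filter_upwards [e.open_source.mem_nhds hxe,
    (e.open_source.preimage continuous_rng).mem_nhds hx'] with a ha ha'
  have h : rng a = a := e.injOn ha' ha (by rw [← he]; exact Subtype.ext (rng_rng a))
  show src a = a
  rw [← h, src_rng]

lemma isClopen_units [IsAmple G] [T2Space G] : IsClopen {x : G | src x = x} :=
  ⟨isClosed_eq continuous_src continuous_id, isOpen_units⟩

/-- Every arrow has a neighbourhood basis of compact open sets on which both the range and the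
source map are injective. -/
lemma exists_compact_open_bisection [IsAmple G] (K : Set G) (hKo : IsOpen K) (a : G)
    (ha : a ∈ K) :
    ∃ D : Set G, IsCompact D ∧ IsOpen D ∧ a ∈ D ∧ D ⊆ K ∧
      Set.InjOn (r : G → UnitSpace G) D ∧ Set.InjOn (s : G → UnitSpace G) D := by
  -- Inversion exchanges source and range, so range-injectivity near the inverse of `a` becomes
  -- source-injectivity near `a`.
  obtain ⟨E, -, hE, haE, -, hEi⟩ := exists_compact_bisection Set.univ isOpen_univ (inv a) trivial
  obtain ⟨D, hDc, hDo, haD, hDK, hDi⟩ := exists_compact_bisection (K ∩ inv ⁻¹' E)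
    (hKo.inter (hE.preimage IsEtale.continuous_inv)) a ⟨ha, haE⟩
  refine ⟨D, hDc, hDo, haD, fun x hx => (hDK hx).1, hDi, fun x hx y hy hxy => ?_⟩
  have := hEi (hDK hx).2 (hDK hy).2 (by rw [r_inv, r_inv, hxy])
  rw [← ArrowGroupoid.inv_inv x, this, ArrowGroupoid.inv_inv]

/-- Compact open sets of units form a basis of the topology of the unit space. -/
lemma exists_compact_open_units [IsAmple G] {W : Set (UnitSpace G)} (hW : IsOpen W)
    {x : UnitSpace G} (hx : x ∈ W) :
    ∃ V : Set G, IsCompact V ∧ IsOpen V ∧ (x : G) ∈ V ∧ (∀ a ∈ V, src a = a) ∧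
      ∀ a ∈ V, r a ∈ W := by
  obtain ⟨V, hVc, hVo, hxV, hVK, -⟩ := exists_compact_bisection
    ({x : G | src x = x} ∩ r ⁻¹' W) (isOpen_units.inter (hW.preimage continuous_r)) (x : G)
    ⟨x.2, by simpa [r_coe] using hx⟩
  exact ⟨V, hVc, hVo, hxV, fun a ha => (hVK ha).1, fun a ha => (hVK ha).2⟩

end Topological

end ArrowGroupoid

namespace SteinbergAlgebra

open ArrowGroupoid

/-! ### Left division at units. -/

section Division

variable {G : Type*} [ArrowGroupoid G]

lemma ldiv_rng (γ : G) : ldiv γ ⟨rng γ, rng_rng γ⟩ = γ := by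
  have h := rng_mul_self γ
  rw [ldiv, mul_congr (inv_of_src_eq (src_rng γ)) rfl _ (src_rng γ), h]

lemma ldiv_self (γ : G) : ldiv γ ⟨γ, rfl⟩ = src γ := inv_mul γ

lemma eq_of_src_ldiv {γ : G} (a : {a : G // rng a = rng γ})
    (h : src (ldiv γ a) = ldiv γ a) : a.1 = γ := by
  have h1 : src a.1 = rng (ldiv γ a) := by simp [ldiv, rng_mul, rng_inv]
  have h2 : mul a.1 (ldiv γ a) h1 = γ := mul_inv_cancel_left a.1 γ a.2 h1
  have h3 : ldiv γ a = src a.1 := by rw [h1, rng_of_src_eq h]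
  rw [mul_congr rfl h3 h1 (rng_src _).symm, mul_src] at h2
  exact h2

lemma rng_ldiv (γ : G) (a : {a : G // rng a = rng γ}) : rng (ldiv γ a) = src a.1 := by
  rw [ldiv, rng_mul, rng_inv]

end Division

/-! ### Convolution with unit-supported and characteristic functions. -/

section Products

variable {R G : Type*} [CommRing R] [TopologicalSpace G] [T2Space G]

/-- The characteristic function of a compact open set. -/
noncomputable def char (R : Type*) [CommRing R] (D : Set G) (hDc : IsCompact D) (hDo : IsOpen D) :
    SteinbergAlgebra R G :=
  of (D.indicator fun _ => (1 : R)) ((IsLocallyConstant.iff_eventually_eq _).2 fun x => by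
    by_cases hx : x ∈ D
    · filter_upwards [hDo.mem_nhds hx] with y hy
      rw [Set.indicator_of_mem hx, Set.indicator_of_mem hy]
    · filter_upwards [hDc.isClosed.isOpen_compl.mem_nhds hx] with y hy
      rw [Set.indicator_of_notMem hx, Set.indicator_of_notMem hy]) D hDc
    fun _ ha => Set.indicator_of_notMem ha _

lemma char_of_mem {D : Set G} (hDc : IsCompact D) (hDo : IsOpen D) {a : G} (ha : a ∈ D) :
    char R D hDc hDo a = 1 := by
  rw [char, of_apply, Set.indicator_of_mem ha]

lemma char_of_notMem {D : Set G} (hDc : IsCompact D) (hDo : IsOpen D) {a : G} (ha : a ∉ D) :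
    char R D hDc hDo a = 0 := by
  rw [char, of_apply, Set.indicator_of_notMem ha]

variable [ArrowGroupoid G] [IsAmple G]

/-- The only factorization of `γ` whose left factor is a unit is `rng γ` times `γ`, so
unit-supported elements act by pointwise multiplication through the range map. -/
lemma mul_apply_of_units_left {f : SteinbergAlgebra R G} (hf : ∀ a, src a ≠ a → f a = 0)
    (g : SteinbergAlgebra R G) (γ : G) : (f * g) γ = f (rng γ) * g γ := by
  rw [mul_apply, conv_eq, finsum_eq_single _ (⟨rng γ, rng_rng γ⟩ : {a : G // rng a = rng γ}),
    ldiv_rng]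
  intro a ha
  rw [hf a.1 fun h => ha (Subtype.ext ?_), zero_mul]
  rw [← rng_of_src_eq h, a.2]

lemma mul_apply_of_units_right {f : SteinbergAlgebra R G} (hf : ∀ a, src a ≠ a → f a = 0)
    (g : SteinbergAlgebra R G) (γ : G) : (g * f) γ = g γ * f (src γ) := by
  rw [mul_apply, conv_eq, finsum_eq_single _ (⟨γ, rfl⟩ : {a : G // rng a = rng γ}), ldiv_self]
  intro a ha
  rw [hf _ fun h => ha (Subtype.ext (eq_of_src_ldiv a h)), mul_zero]

/-- Injectivity of the range map on `D` leaves one term in the convolution sum: multiplying by the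
characteristic function translates by the arrow of `D` with the right range. -/
lemma char_mul_apply {D : Set G} (hDc : IsCompact D) (hDo : IsOpen D)
    (hD : Set.InjOn (r : G → UnitSpace G) D) (f : SteinbergAlgebra R G) (γ : G)
    (a : {a : G // rng a = rng γ}) (ha : a.1 ∈ D) :
    (char R D hDc hDo * f) γ = f (ldiv γ a) := by
  rw [mul_apply, conv_eq, finsum_eq_single _ a, char_of_mem hDc hDo ha, one_mul]
  intro b hb
  rw [char_of_notMem hDc hDo fun h => hb (Subtype.ext (hD h ha (r_eq_iff.2 (b.2.trans a.2.symm)))),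
    zero_mul]

lemma exists_of_char_mul_ne_zero {D : Set G} (hDc : IsCompact D) (hDo : IsOpen D)
    {f : SteinbergAlgebra R G} {γ : G} (h : (char R D hDc hDo * f) γ ≠ 0) :
    ∃ a : {a : G // rng a = rng γ}, a.1 ∈ D := by
  contrapose! h
  rw [mul_apply, conv_eq]
  exact finsum_eq_zero_of_forall_eq_zero fun a => by
    rw [char_of_notMem hDc hDo (h a), zero_mul]

end Products

/-! ### The graded ideal of an open invariant set. -/

section RestrictionIdeal

variable {R G : Type*} [CommRing R] [TopologicalSpace G] [T2Space G] [ArrowGroupoid G] [IsAmple G]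

lemma mem_ofRestrict {U : OpenInvariant G} {f : SteinbergAlgebra R G} :
    f ∈ ofRestrict R U ↔ ∀ a, r a ∉ U.1 → f a = 0 :=
  mem_range_extendByZero _ _ f

/-- The algebra `A_R(G|_U)` as a two-sided ideal. -/
noncomputable def restrictIdeal (R : Type*) [CommRing R] (U : OpenInvariant G) :
    TwoSidedIdeal (SteinbergAlgebra R G) :=
  TwoSidedIdeal.mk' (ofRestrict R U : Set (SteinbergAlgebra R G)) (zero_mem _)
    (fun hx hy => add_mem hx hy) (fun hx => neg_mem hx)
    -- This is where invariance enters: the right factor has as range the source of the left factor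
    -- `a`, whose range is that of `γ`. For right multiplication, the left factor already has the
    -- range of `γ`.
    (fun {f g} hg => mem_ofRestrict.2 fun γ hγ => by
      rw [mul_apply, conv_eq]
      refine finsum_eq_zero_of_forall_eq_zero fun a => ?_
      rw [mem_ofRestrict.1 hg, mul_zero]
      have h1 : r (ldiv γ a) = s a.1 := Subtype.ext (rng_ldiv γ a)
      rw [h1]
      have h2 : r a.1 ∉ U.1 := by rwa [r_eq_iff.2 a.2]
      exact fun h => h2 ((U.2 a.1).2 h))
    (fun {f g} hf => mem_ofRestrict.2 fun γ hγ => by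
      rw [mul_apply, conv_eq]
      refine finsum_eq_zero_of_forall_eq_zero fun a => ?_
      rw [mem_ofRestrict.1 hf a.1 (by rwa [r_eq_iff.2 a.2]), zero_mul])

lemma coe_restrictIdeal (U : OpenInvariant G) :
    (restrictIdeal R U : Set (SteinbergAlgebra R G)) = ofRestrict R U :=
  TwoSidedIdeal.coe_mk' ..

lemma mem_restrictIdeal {U : OpenInvariant G} {f : SteinbergAlgebra R G} :
    f ∈ restrictIdeal R U ↔ ∀ a, r a ∉ U.1 → f a = 0 :=
  (TwoSidedIdeal.mem_mk' ..).trans mem_ofRestrict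

lemma isGraded_restrictIdeal {Γ : Type*} [Group Γ] (c : LCCocycle G Γ) (U : OpenInvariant G) :
    IsGraded c (restrictIdeal R U) :=
  (isGraded_iff c _).2 fun f hf g => mem_restrictIdeal.2 fun a ha => by
    rw [component_apply, mem_restrictIdeal.1 hf a ha, ite_self]

/-- The ideal detects each point of `U` through the characteristic function of a compact open set of
units around it. -/
lemma restrictIdeal_le_iff [Nontrivial R] {U V : OpenInvariant G} :
    restrictIdeal R U ≤ restrictIdeal R V ↔ U ≤ V := by
  constructor
  · intro h x hx
    obtain ⟨D, hDc, hDo, hxD, -, hDU⟩ := exists_compact_open_units U.1.isOpen hx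
    have h1 : char R D hDc hDo ∈ restrictIdeal R U :=
      mem_restrictIdeal.2 fun a ha => char_of_notMem _ _ fun haD => ha (hDU a haD)
    by_contra hxV
    have h2 := mem_restrictIdeal.1 (h h1) (x : G) (by rwa [r_coe])
    rw [char_of_mem hDc hDo hxD] at h2
    exact one_ne_zero h2
  · intro h f hf
    exact mem_restrictIdeal.2 fun a ha => mem_restrictIdeal.1 hf a fun hU => ha (h hU)

end RestrictionIdeal

end SteinbergAlgebra

namespace ArrowGroupoid

/-! ### Consequences of strong effectivity of the kernel. -/

section Effectivity

variable {G Γ : Type*} [TopologicalSpace G] [ArrowGroupoid G] [Group Γ]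

/-- If the kernel of a cocycle is strongly effective, then over a closed invariant set every
non-unit arrow of the kernel is a limit of arrows of the kernel that are not in the isotropy. -/
lemma exists_rng_ne_src (c : LCCocycle G Γ) (hc : StronglyEffective c.kernel.carrier)
    {C : Set (UnitSpace G)} (hC : Invariant C) (hCc : IsClosed C) {b : G} (hb : c.toFun b = 1)
    (hbC : r b ∈ C) (hbu : src b ≠ b) {O : Set G} (hO : IsOpen O) (hbO : b ∈ O) :
    ∃ a ∈ O, c.toFun a = 1 ∧ r a ∈ C ∧ rng a ≠ src a := by
  -- Effectivity concerns closed invariant sets of units of the kernel, so `C` is pulled back along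
  -- the inclusion of unit spaces.
  let ι : UnitSpace c.kernel.carrier → UnitSpace G :=
    fun u => ⟨u.1.1, congrArg Subtype.val u.2⟩
  have hι : Continuous ι :=
    (continuous_subtype_val.comp continuous_subtype_val).subtype_mk _
  have hinv : Invariant (ι ⁻¹' C) := fun a => hC a.1
  have heff := hc (ι ⁻¹' C) hinv (hCc.preimage hι)
  by_contra! h
  let β : (restrict (ι ⁻¹' C) hinv).carrier := ⟨⟨b, hb⟩, hbC⟩
  have hβ : β ∈ interior (Iso (restrict (ι ⁻¹' C) hinv).carrier) := by
    -- If every arrow of the kernel in `O` over `C` were isotropy, `b` would be interior to the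
    -- isotropy of the restriction, hence a unit.
    refine mem_interior.2 ⟨{x | x.1.1 ∈ O}, fun x hx => ?_, ?_, hbO⟩
    · exact Subtype.ext (Subtype.ext (h x.1.1 hx x.1.2 x.2))
    · exact hO.preimage (continuous_subtype_val.comp continuous_subtype_val)
  rw [heff] at hβ
  exact hbu (congrArg (fun x => x.1.1) hβ)

variable [IsAmple G]

open SteinbergAlgebra (continuous_r continuous_rng continuous_src exists_compact_bisection)

/-- The units without isotropy in a given bisection of non-unit arrows are dense. -/
lemma exists_open_avoiding_bisection [T2Space G] (c : LCCocycle G Γ)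
    (hc : StronglyEffective c.kernel.carrier) {C : Set (UnitSpace G)} (hC : Invariant C)
    (hCc : IsClosed C) {D : Set G} (hDo : IsOpen D) (hD : Set.InjOn (r : G → UnitSpace G) D)
    (hD1 : ∀ a ∈ D, c.toFun a = 1) (hDu : ∀ a ∈ D, src a ≠ a) {W : Set (UnitSpace G)}
    (hW : IsOpen W) (hWC : (W ∩ C).Nonempty) :
    ∃ W' ⊆ W, IsOpen W' ∧ (W' ∩ C).Nonempty ∧
      ∀ a ∈ D, rng a = src a → r a ∈ W' → r a ∉ C := by
  by_cases h : ∀ a ∈ D, rng a = src a → r a ∈ W → r a ∉ C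
  · exact ⟨W, subset_rfl, hW, hWC, h⟩
  push Not at h
  obtain ⟨b, hbD, -, hbW, hbC⟩ := h
  have hO : IsOpen (D ∩ r ⁻¹' W) := hDo.inter (hW.preimage continuous_r)
  obtain ⟨a, haO, -, haC, hane⟩ :=
    exists_rng_ne_src c hc hC hCc (hD1 b hbD) hbC (hDu b hbD) hO ⟨hbD, hbW⟩
  have hO' : IsOpen ((D ∩ r ⁻¹' W) ∩ {d | rng d ≠ src d}) :=
    hO.inter (isClosed_eq continuous_rng continuous_src).isOpen_compl
  -- The new set consists of the ranges of the non-isotropy arrows of `D` over `W`. An isotropy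
  -- arrow of `D` with such a range would equal a non-isotropy arrow, by injectivity on `D`.
  refine ⟨r '' ((D ∩ r ⁻¹' W) ∩ {d | rng d ≠ src d}), ?_,
    IsEtale.isLocalHomeomorph_r.isOpenMap _ hO', ⟨r a, ⟨a, ⟨haO, hane⟩, rfl⟩, haC⟩, ?_⟩
  · rintro _ ⟨d, hd, rfl⟩
    exact hd.1.2
  · rintro d hdD hds ⟨d', hd', hr⟩
    rw [hD hd'.1.1 hdD hr] at hd'
    exact absurd hds hd'.2

/-- The units without isotropy in a given compact open set of non-unit arrows are dense. -/
lemma exists_open_avoiding [T2Space G] (c : LCCocycle G Γ)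
    (hc : StronglyEffective c.kernel.carrier) {C : Set (UnitSpace G)} (hC : Invariant C)
    (hCc : IsClosed C) {B : Set G} (hBc : IsCompact B) (hBo : IsOpen B)
    (hB1 : ∀ a ∈ B, c.toFun a = 1) (hBu : ∀ a ∈ B, src a ≠ a) {W : Set (UnitSpace G)}
    (hW : IsOpen W) (hWC : (W ∩ C).Nonempty) :
    ∃ W' ⊆ W, IsOpen W' ∧ (W' ∩ C).Nonempty ∧
      ∀ a ∈ B, rng a = src a → r a ∈ W' → r a ∉ C := by
  classical
  choose! D _ hDo haD hDB hDi using exists_compact_bisection B hBo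
  obtain ⟨t, ht, hcov⟩ := hBc.elim_nhds_subcover D (fun a ha => (hDo a ha).mem_nhds (haD a ha))
  -- The open set is shrunk once for each bisection of a finite cover; what was avoided earlier
  -- stays avoided after shrinking.
  have key : ∀ u : Finset G, u ⊆ t → ∃ W' ⊆ W, IsOpen W' ∧ (W' ∩ C).Nonempty ∧
      ∀ x ∈ u, ∀ a ∈ D x, rng a = src a → r a ∈ W' → r a ∉ C := by
    intro u
    induction u using Finset.induction_on with
    | empty => exact fun _ => ⟨W, subset_rfl, hW, hWC, by simp⟩
    | insert x u _ ih =>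
      intro hu
      obtain ⟨W₁, h₁, hW₁, hW₁C, hav⟩ := ih fun y hy => hu (Finset.mem_insert_of_mem hy)
      have hx := ht x (hu (Finset.mem_insert_self x u))
      obtain ⟨W₂, h₂, hW₂, hW₂C, hav₂⟩ := exists_open_avoiding_bisection c hc hC hCc (hDo x hx)
        (hDi x hx) (fun a ha => hB1 a (hDB x hx ha)) (fun a ha => hBu a (hDB x hx ha)) hW₁ hW₁C
      refine ⟨W₂, h₂.trans h₁, hW₂, hW₂C, fun y hy a ha has haW => ?_⟩
      rcases Finset.mem_insert.1 hy with rfl | hy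
      · exact hav₂ a ha has haW
      · exact hav y hy a ha has (h₂ haW)
  obtain ⟨W', h', hW', hW'C, hav⟩ := key t subset_rfl
  refine ⟨W', h', hW', hW'C, fun a ha => ?_⟩
  obtain ⟨x, hx, hax⟩ := Set.mem_iUnion₂.1 (hcov ha)
  exact hav x hx a hax

/-- Over a closed invariant set, there are arbitrarily small open sets of units between which no
arrow of a given compact open set of non-unit arrows runs. -/
lemma exists_open_separating [T2Space G] (c : LCCocycle G Γ)
    (hc : StronglyEffective c.kernel.carrier) {C : Set (UnitSpace G)} (hC : Invariant C)
    (hCc : IsClosed C) {B : Set G} (hBc : IsCompact B) (hBo : IsOpen B)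
    (hB1 : ∀ a ∈ B, c.toFun a = 1) (hBu : ∀ a ∈ B, src a ≠ a) {W : Set (UnitSpace G)}
    (hW : IsOpen W) (hWC : (W ∩ C).Nonempty) :
    ∃ V ⊆ W, IsOpen V ∧ (V ∩ C).Nonempty ∧ ∀ a ∈ B, r a ∈ V → s a ∈ V → r a ∉ C := by
  obtain ⟨W', h', hW', ⟨y, hyW, hyC⟩, hav⟩ :=
    exists_open_avoiding c hc hC hCc hBc hBo hB1 hBu hW hWC
  -- The range-source pairs of arrows of `B` over `C` form a compact, hence closed, set. It misses
  -- `(y, y)` because `B` has no isotropy at `y`, so a box around `(y, y)` misses it too.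
  have hcl : IsClosed ((fun a : G => (r a, s a)) '' (B ∩ r ⁻¹' C)) :=
    ((hBc.inter_right (hCc.preimage continuous_r)).image
      (continuous_r.prodMk continuous_s)).isClosed
  have hy : (y, y) ∈ ((fun a : G => (r a, s a)) '' (B ∩ r ⁻¹' C))ᶜ := by
    rintro ⟨a, ⟨haB, haC⟩, he⟩
    obtain ⟨h1, h2⟩ := Prod.mk.inj he
    exact hav a haB (congrArg Subtype.val (h1.trans h2.symm)) (h1 ▸ hyW) haC
  obtain ⟨V₁, V₂, hV₁, hV₂, hy₁, hy₂, hV⟩ := isOpen_prod_iff.1 hcl.isOpen_compl y y hy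
  exact ⟨W' ∩ (V₁ ∩ V₂), fun x hx => h' hx.1, hW'.inter (hV₁.inter hV₂),
    ⟨y, ⟨hyW, hy₁, hy₂⟩, hyC⟩, fun a ha hr hs haC =>
      hV (Set.mk_mem_prod hr.2.1 hs.2.2) ⟨a, ⟨ha, haC⟩, rfl⟩⟩

end Effectivity

end ArrowGroupoid

namespace SteinbergAlgebra

open ArrowGroupoid

/-! ### The open invariant set of an ideal. -/

section UnitSupport

variable {K G : Type*} [Field K] [TopologicalSpace G] [T2Space G] [ArrowGroupoid G] [IsAmple G]

/-- The units at which some element of an ideal that is supported on the unit space is nonzero. -/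
def unitSupport (J : TwoSidedIdeal (SteinbergAlgebra K G)) : Set (UnitSpace G) :=
  {x | ∃ f ∈ J, (∀ a, src a ≠ a → f a = 0) ∧ f (x : G) ≠ 0}

lemma isOpen_unitSupport (J : TwoSidedIdeal (SteinbergAlgebra K G)) : IsOpen (unitSupport J) := by
  refine isOpen_iff_mem_nhds.2 ?_
  rintro x ⟨f, hfJ, hfu, hfx⟩
  filter_upwards [(f.isClopen_support.2.preimage continuous_subtype_val).mem_nhds hfx] with y hy
  exact ⟨f, hfJ, hfu, hy⟩

lemma char_mem_of_const {J : TwoSidedIdeal (SteinbergAlgebra K G)} {f : SteinbergAlgebra K G}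
    (hf : f ∈ J) (hfu : ∀ a, src a ≠ a → f a = 0) {V : Set G} (hVc : IsCompact V) (hVo : IsOpen V)
    {k : K} (hk : k ≠ 0) (hV : ∀ a ∈ V, f a = k) : char K V hVc hVo ∈ J := by
  have hVu : ∀ a ∈ V, src a = a := fun a ha => by
    by_contra h
    exact hk ((hV a ha).symm.trans (hfu a h))
  -- Products of unit-supported functions are pointwise, so `f` can be cut down to `V` and divided
  -- by its constant value there; this uses that `K` is a field.
  have : char K V hVc hVo = (k⁻¹ • char K V hVc hVo) * f := by
    ext a
    rw [mul_apply_of_units_left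
      (fun b hb => by rw [smul_apply, char_of_notMem _ _ fun h => hb (hVu b h), mul_zero]),
      smul_apply]
    by_cases ha : a ∈ V
    · rw [rng_of_src_eq (hVu a ha), char_of_mem _ _ ha, hV a ha, mul_one, inv_mul_cancel₀ hk]
    · rw [char_of_notMem _ _ ha]
      by_cases hau : src a = a
      · rw [rng_of_src_eq hau, char_of_notMem _ _ ha, mul_zero, zero_mul]
      · rw [hfu a hau, mul_zero]
  rw [this]
  exact J.mul_mem_left _ _ hf

lemma exists_char_mem {J : TwoSidedIdeal (SteinbergAlgebra K G)} {x : UnitSpace G}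
    (hx : x ∈ unitSupport J) : ∃ (V : Set G) (hVc : IsCompact V) (hVo : IsOpen V),
      (x : G) ∈ V ∧ (∀ a ∈ V, src a = a) ∧ char K V hVc hVo ∈ J := by
  obtain ⟨f, hfJ, hfu, hfx⟩ := hx
  have hW : IsOpen ((fun y : UnitSpace G => f (y : G)) ⁻¹' {f (x : G)}) :=
    (f.isLocallyConstant.comp_continuous continuous_subtype_val).isOpen_fiber _
  obtain ⟨V, hVc, hVo, hxV, hVu, hVW⟩ := exists_compact_open_units hW (x := x) rfl
  refine ⟨V, hVc, hVo, hxV, hVu, char_mem_of_const hfJ hfu hVc hVo hfx fun a ha => ?_⟩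
  have : f (rng a) = f (x : G) := hVW a ha
  rwa [rng_of_src_eq (hVu a ha)] at this

/-- Conjugation by a bisection `D` through `a` keeps `f` in the ideal and on the unit space, and
moves its value at the source of `a` to the range of `a`. -/
lemma r_mem_unitSupport {J : TwoSidedIdeal (SteinbergAlgebra K G)} {a : G}
    (ha : s a ∈ unitSupport J) : r a ∈ unitSupport J := by
  obtain ⟨f, hfJ, hfu, hfa⟩ := ha
  obtain ⟨D, hDc, hDo, haD, -, hDr, hDs⟩ := exists_compact_open_bisection Set.univ isOpen_univ a
    trivial
  have hEo : IsOpen (inv ⁻¹' D : Set G) := hDo.preimage IsEtale.continuous_inv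
  have hEc : IsCompact (inv ⁻¹' D : Set G) := by
    rw [← Set.image_eq_preimage_of_inverse (f := (inv : G → G)) ArrowGroupoid.inv_inv
      ArrowGroupoid.inv_inv]
    exact hDc.image IsEtale.continuous_inv
  have hval : ∀ (γ : G) (b : {b : G // rng b = rng γ}), b.1 ∈ D →
      (char K D hDc hDo * (f * char K (inv ⁻¹' D) hEc hEo)) γ =
        f (src b.1) * char K (inv ⁻¹' D) hEc hEo (ldiv γ b) := fun γ b hb => by
    rw [char_mul_apply hDc hDo hDr _ γ b hb, mul_apply_of_units_left hfu, rng_ldiv]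
  refine ⟨char K D hDc hDo * (f * char K (inv ⁻¹' D) hEc hEo),
    J.mul_mem_left _ _ (J.mul_mem_right _ _ hfJ), fun γ hγ => ?_, ?_⟩
  · by_contra hne
    obtain ⟨b, hb⟩ := exists_of_char_mul_ne_zero hDc hDo hne
    rw [hval γ b hb] at hne
    have hbE : inv (ldiv γ b) ∈ D := by
      by_contra h
      exact hne (by rw [char_of_notMem hEc hEo h, mul_zero])
    -- Both arrows lie in `D` and have the same source, so source-injectivity identifies them. Then
    -- `γ` is `b` times its inverse, a unit.
    have h1 : inv (ldiv γ b) = b.1 :=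
      hDs hbE hb (by rw [s_inv]; exact Subtype.ext (rng_ldiv γ b))
    have h2 : ldiv γ b = inv b.1 := by rw [← h1, ArrowGroupoid.inv_inv]
    have h3 : mul b.1 (ldiv γ b) (rng_ldiv γ b).symm = γ := mul_inv_cancel_left b.1 γ b.2 _
    rw [mul_congr rfl h2 _ (rng_inv _).symm, ArrowGroupoid.mul_inv] at h3
    exact hγ (by rw [← h3, src_rng])
  · have h1 : ldiv (rng a) ⟨a, (rng_rng a).symm⟩ = inv a := by
      rw [ldiv, mul_congr rfl (src_inv a).symm _ (rng_src _).symm, mul_src]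
    show (char K D hDc hDo * (f * char K (inv ⁻¹' D) hEc hEo)) (rng a) ≠ 0
    rw [hval (rng a) ⟨a, (rng_rng a).symm⟩ haD, h1, char_of_mem hEc hEo
      (by rwa [Set.mem_preimage, ArrowGroupoid.inv_inv]), mul_one]
    exact hfa

lemma invariant_unitSupport (J : TwoSidedIdeal (SteinbergAlgebra K G)) :
    Invariant (unitSupport J) := fun a =>
  ⟨fun h => by
    have := r_mem_unitSupport (a := inv a) (by rwa [s_inv])
    rwa [r_inv] at this, r_mem_unitSupport⟩

/-- The open invariant set attached to an ideal. -/
def openSupport (J : TwoSidedIdeal (SteinbergAlgebra K G)) : OpenInvariant G :=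
  ⟨⟨unitSupport J, isOpen_unitSupport J⟩, invariant_unitSupport J⟩

/-- By compactness, the ranges of the arrows in the support of `f` are covered by finitely many
compact open sets of units whose characteristic functions lie in `J`. Neither grading nor
effectivity is needed. -/
lemma restrictIdeal_openSupport_le (J : TwoSidedIdeal (SteinbergAlgebra K G)) :
    restrictIdeal K (openSupport J) ≤ J := by
  classical
  have key : ∀ (t : Finset G) (V : G → Set G) (hVc : ∀ x ∈ t, IsCompact (V x))
      (hVo : ∀ x ∈ t, IsOpen (V x)), (∀ x ∈ t, ∀ a ∈ V x, src a = a) →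
      (∀ x (hx : x ∈ t), char K (V x) (hVc x hx) (hVo x hx) ∈ J) →
      ∀ f : SteinbergAlgebra K G, (∀ a, f a ≠ 0 → ∃ x ∈ t, rng a ∈ V x) → f ∈ J := by
    intro t V
    induction t using Finset.induction_on with
    | empty =>
      intro _ _ _ _ f hf
      have : f = 0 := by
        ext a
        by_contra h
        simpa using hf a h
      rw [this]
      exact J.zero_mem
    | insert x t _ ih =>
      intro hVc hVo hVu hVJ f hf
      have hx := Finset.mem_insert_self x t
      have ht : ∀ y ∈ t, y ∈ insert x t := fun y hy => Finset.mem_insert_of_mem hy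
      have h1 : char K (V x) (hVc x hx) (hVo x hx) * f ∈ J := J.mul_mem_right _ _ (hVJ x hx)
      have hap : ∀ a, (char K (V x) (hVc x hx) (hVo x hx) * f) a =
          char K (V x) (hVc x hx) (hVo x hx) (rng a) * f a := fun a =>
        mul_apply_of_units_left (fun b hb => char_of_notMem _ _ fun h => hb (hVu x hx b h)) f a
      -- Subtracting the part of `f` over `V x`, which is already in `J`, leaves a function covered
      -- by the remaining sets.
      have h2 : f + -(char K (V x) (hVc x hx) (hVo x hx) * f) ∈ J := by
        refine ih (fun y hy => hVc y (ht y hy)) (fun y hy => hVo y (ht y hy))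
          (fun y hy => hVu y (ht y hy)) (fun y hy => hVJ y (ht y hy)) _ fun a ha => ?_
        rw [add_apply, neg_apply, hap] at ha
        by_cases hax : rng a ∈ V x
        · exact absurd (by rw [char_of_mem _ _ hax, one_mul, add_neg_cancel]) ha
        · rw [char_of_notMem _ _ hax, zero_mul, neg_zero, add_zero] at ha
          obtain ⟨y, hy, hay⟩ := hf a ha
          rcases Finset.mem_insert.1 hy with rfl | hy
          · exact absurd hay hax
          · exact ⟨y, hy, hay⟩
      simpa using J.add_mem h2 h1
  intro f hf
  have hsupp : ∀ a ∈ Function.support f, r a ∈ unitSupport J := fun a ha => by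
    by_contra h
    exact ha (mem_restrictIdeal.1 hf a h)
  choose! V hVc hVo haV hVu hVJ using fun a (ha : a ∈ Function.support f) =>
    exists_char_mem (hsupp a ha)
  obtain ⟨t, ht, hcov⟩ := f.isCompact_support.elim_nhds_subcover (fun a => rng ⁻¹' V a)
    fun a ha => ((hVo a ha).preimage continuous_rng).mem_nhds (haV a ha)
  refine key t V (fun x hx => hVc x (ht x hx)) (fun x hx => hVo x (ht x hx))
    (fun x hx => hVu x (ht x hx)) (fun x hx => hVJ x (ht x hx)) f fun a ha => ?_
  simpa using hcov ha

end UnitSupport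

/-! ### Graded ideals are determined by their unit support. -/

section GradedIdeals

variable {K G Γ : Type*} [Field K] [TopologicalSpace G] [T2Space G] [ArrowGroupoid G] [IsAmple G]
  [Group Γ]

/-- An element of degree `1` of an ideal vanishes at the units outside the support of the ideal. -/
lemma apply_eq_zero_of_notMem_unitSupport (c : LCCocycle G Γ)
    (hc : StronglyEffective c.kernel.carrier) {J : TwoSidedIdeal (SteinbergAlgebra K G)}
    {f : SteinbergAlgebra K G} (hfJ : f ∈ J) (hf1 : f ∈ homogeneous K c 1) {x : UnitSpace G}
    (hx : x ∉ unitSupport J) : f (x : G) = 0 := by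
  by_contra hfx
  -- The non-unit part of the support of `f` is compact open because the unit space is clopen, and
  -- it lies in the kernel because `f` has degree `1`.
  have hBcl : IsClopen (Function.support f ∩ {a : G | src a = a}ᶜ) :=
    f.isClopen_support.inter isClopen_units.compl
  have hCinv : Invariant (unitSupport J)ᶜ := fun a => not_congr (invariant_unitSupport J a)
  have hW : IsOpen ((fun y : UnitSpace G => f (y : G)) ⁻¹' {f (x : G)}) :=
    (f.isLocallyConstant.comp_continuous continuous_subtype_val).isOpen_fiber _
  obtain ⟨N, hNW, hNo, ⟨y, hyN, hyC⟩, hN⟩ := exists_open_separating c hc hCinv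
    (isOpen_unitSupport J).isClosed_compl
    (f.isCompact_support.of_isClosed_subset hBcl.1 Set.inter_subset_left) hBcl.2
    (fun a ha => by
      by_contra h
      exact ha.1 (hf1 a h))
    (fun a ha => ha.2) hW ⟨x, rfl, hx⟩
  obtain ⟨V, hVc, hVo, hyV, hVu, hVN⟩ := exists_compact_open_units hNo hyN
  have hVu' : ∀ a, src a ≠ a → char K V hVc hVo a = 0 := fun a ha =>
    char_of_notMem _ _ fun h => ha (hVu a h)
  have hval : ∀ a, (char K V hVc hVo * f * char K V hVc hVo) a =
      char K V hVc hVo (rng a) * f a * char K V hVc hVo (src a) := fun a => by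
    rw [mul_apply_of_units_right hVu', mul_apply_of_units_left hVu']
  have hkJ : char K V hVc hVo * f * char K V hVc hVo ∈ J :=
    J.mul_mem_right _ _ (J.mul_mem_left _ _ hfJ)
  have hfV : ∀ a ∈ V, f a = f (x : G) := fun a ha => by
    have : f (rng a) = f (x : G) := hNW (hVN a ha)
    rwa [rng_of_src_eq (hVu a ha)] at this
  -- The compression of `f` to `V` agrees with a constant multiple of the characteristic function at
  -- units. At a non-unit arrow it can be nonzero only if both endpoints lie in `N`, and the choice
  -- of `N` rules this out over the complement of the support.
  have hdiff : char K V hVc hVo * f * char K V hVc hVo + -(f (x : G) • char K V hVc hVo) ∈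
      restrictIdeal K (openSupport J) := by
    refine mem_restrictIdeal.2 fun a ha => ?_
    rw [add_apply, hval, neg_apply, smul_apply]
    by_cases hau : src a = a
    · rw [hau, rng_of_src_eq hau]
      by_cases haV : a ∈ V
      · rw [char_of_mem _ _ haV, hfV a haV, one_mul, add_neg_cancel]
      · rw [char_of_notMem _ _ haV, mul_zero, mul_zero, neg_zero, add_zero]
    · rw [hVu' a hau, mul_zero, neg_zero, add_zero]
      by_cases h0 : f a = 0
      · rw [h0, mul_zero, zero_mul]
      by_cases h1 : rng a ∈ V
      · by_cases h2 : src a ∈ V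
        · have h1' : r a ∈ N := r_coe (r a) ▸ hVN _ h1
          have h2' : s a ∈ N := r_coe (s a) ▸ hVN _ h2
          exact absurd ha (hN a ⟨h0, hau⟩ h1' h2')
        · rw [char_of_notMem _ _ h2, mul_zero]
      · rw [char_of_notMem _ _ h1, zero_mul, zero_mul]
  have hmem : f (x : G) • char K V hVc hVo ∈ J := by
    have h := J.sub_mem hkJ (restrictIdeal_openSupport_le J hdiff)
    simpa using h
  -- The contradiction occurs at `y`, the point of `N` outside the support, which need not be `x`.
  exact hyC ⟨_, hmem, fun a ha => by rw [smul_apply, hVu' a ha, mul_zero], by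
    rwa [smul_apply, char_of_mem _ _ hyV, mul_one]⟩

/-- Gradedness allows one component of `f` to be treated alone; a translation by the inverse of `a`
then brings it to degree `1` and carries its value at `a` to the unit `src a`, which is outside the
support by invariance. -/
lemma le_restrictIdeal_openSupport (c : LCCocycle G Γ)
    (hc : StronglyEffective c.kernel.carrier) {J : TwoSidedIdeal (SteinbergAlgebra K G)}
    (hJ : IsGraded c J) : J ≤ restrictIdeal K (openSupport J) := by
  intro f hf
  refine mem_restrictIdeal.2 fun a ha => ?_
  have hs : s a ∉ unitSupport J := fun h => ha ((invariant_unitSupport J a).2 h)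
  let g := c.toFun a
  have hfgJ : component c g f ∈ J := (isGraded_iff c J).1 hJ f hf g
  have hg : c.toFun (inv a) = g⁻¹ := by
    have h := c.isCocycle (inv a) a (src_inv a)
    rw [inv_mul, ← rng_src, c.isCocycle.map_rng] at h
    exact eq_inv_of_mul_eq_one_left h.symm
  -- The bisection is taken inside a single fibre of the cocycle so that its characteristic function
  -- is homogeneous of degree `g⁻¹`.
  obtain ⟨E, hEc, hEo, haE, hEg, hEr⟩ := exists_compact_bisection (c.toFun ⁻¹' {g⁻¹})
    (c.isClopen_fibre g⁻¹).2 (inv a) hg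
  have hE : char K E hEc hEo ∈ homogeneous K c g⁻¹ := fun b hb =>
    char_of_notMem _ _ fun h => hb (hEg h)
  have h1 := homogeneous_mul_mem c _ _ _ _ hE (component_mem c g f)
  rw [inv_mul_cancel] at h1
  have h0 := apply_eq_zero_of_notMem_unitSupport c hc (J.mul_mem_left _ _ hfgJ) h1 hs
  have hra : rng (inv a) = rng (src a) := by rw [rng_inv, rng_src]
  have h2 : ldiv (src a) ⟨inv a, hra⟩ = a := by
    rw [ldiv, mul_congr (ArrowGroupoid.inv_inv a) rfl _ (rng_src a).symm, mul_src]
  change (char K E hEc hEo * component c g f) (src a) = 0 at h0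
  rw [char_mul_apply hEc hEo hEr _ (src a) ⟨inv a, hra⟩ haE, h2, component_apply, if_pos rfl] at h0
  exact h0

end GradedIdeals

end SteinbergAlgebra

/-! ### The lattice isomorphism. -/

theorem theorem5p3 {K G Γ : Type*} [Field K] [TopologicalSpace G] [ArrowGroupoid G] [T2Space G]
    [ArrowGroupoid.IsAmple G] [Group Γ] (c : LCCocycle G Γ)
    (hc : ArrowGroupoid.StronglyEffective c.kernel.carrier) :
    ∃ Φ : SteinbergAlgebra.OpenInvariant G ≃o SteinbergAlgebra.GradedIdeal K c,
      (∀ U, ((Φ U).1 : Set (SteinbergAlgebra K G)) = SteinbergAlgebra.ofRestrict K U) ∧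
      (∀ U V, Φ (U ⊔ V) = Φ U ⊔ Φ V) ∧ (∀ U V, Φ (U ⊓ V) = Φ U ⊓ Φ V) := by
  let ι : SteinbergAlgebra.OpenInvariant G ↪o SteinbergAlgebra.GradedIdeal K c :=
    OrderEmbedding.ofMapLEIff (fun U =>
      ⟨SteinbergAlgebra.restrictIdeal K U, SteinbergAlgebra.isGraded_restrictIdeal c U⟩)
      fun U V => SteinbergAlgebra.restrictIdeal_le_iff
  have hι : Function.Surjective ι := fun J => ⟨SteinbergAlgebra.openSupport J.1, Subtype.ext
    (le_antisymm (SteinbergAlgebra.restrictIdeal_openSupport_le J.1)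
      (SteinbergAlgebra.le_restrictIdeal_openSupport c hc J.2))⟩
  -- A surjective order embedding is an order isomorphism, and so preserves joins and meets
  -- automatically.
  let Φ := RelIso.ofSurjective ι hι
  exact ⟨Φ, fun U => SteinbergAlgebra.coe_restrictIdeal U, fun U V => OrderIso.map_sup Φ U V,
    fun U V => OrderIso.map_inf Φ U V⟩
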